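/- Let $n,m,r$ be non-negative integers and let $\mathcal A=\{A_i\}_{i=1}^m$ be $n\times n$ matrices over the field with two elements such that for every $s\in\{0,1\}^m\setminus\{0^m\}$ the matrix $A_s=\sum_{i=1}^m s_iA_i$ satisfies $\operatorname{rank}(A_s)\ge n-r$. Define $$\mathrm{deor}_{\mathcal A}:\{0,1\}^n\times\{0,1\}^n\to\{0,1\}^m,\qquad \mathrm{deor}_{\mathcal A}(x,y)=\big((A_1x)\cdot y,\dots,(A_mx)\cdot y\big),$$ where $\cdot$ is the inner product modulo $2$. Then, for all real $k_1,k_2$, the function $\mathrm{deor}_{\mathcal A}$ is a $$\Big(k_1,\;k_2,\;2^{-\frac{k_1+k_2+3-n-r-2m}{4}}\Big)$$ $X_1$-strong two-source extractor against quantum product-type knowledge. That is: for all finite-dimensional quantum systems $C_1,C_2$ and all density operators $\rho_{X_1C_1}=\sum_{x\in\{0,1\}^n}|x\rangle\langle x|\otimes\rho_{C_1\wedge x}$ and $\rho_{X_2C_2}=\sum_{x\in\{0,1\}^n}|x\rangle\langle x|\otimes\rho_{C_2\wedge x}$ with $H_{\min}(X_1|C_1)\ge k_1$ and $H_{\min}(X_2|C_2)\ge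 k_2$, the state $\rho_{X_1X_2C}=\rho_{X_1C_1}\otimes\rho_{X_2C_2}$, $C=C_1C_2$, satisfies $$\tfrac12\Big\|\rho_{\mathrm{deor}_{\mathcal A}(X_1,X_2)X_1C}-\omega_m\otimes\rho_{X_1C}\Big\|_1\le 2^{-\frac{k_1+k_2+3-n-r-2m}{4}} .$$ Here $\|S\|_1=\operatorname{tr}\sqrt{S^\dagger S}$, $\omega_m=2^{-m}\,\mathrm{id}$ is the maximally mixed state on $m$ bits, $\rho_{X_1C}$ is the partial trace of $\rho_{X_1X_2C}$ over $X_2$, and $$\rho_{\mathrm{deor}_{\mathcal A}(X_1,X_2)X_1C}=\sum_{x_1,x_2}|\mathrm{deor}_{\mathcal A}(x_1,x_2)\rangle\langle \mathrm{deor}_{\mathcal A}(x_1,x_2)|\otimes|x_1\rangle\langle x_1|\otimes\rho_{C_1\wedge x_1}\otimes\rho_{C_2\wedge x_2}.$$ The conditional min-entropy is $H_{\min}(A|B)_\rho=\sup_{\sigma_B}\sup\{z\in\mathbb R:\rho_{AB}\le 2^{-z}\,\mathrm{id}_A\otimes\sigma_B\}$, where $\sigma_B$ ranges over the density operators on $B$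 and $\sup\emptyset=-\infty$. -/

import Mathlib

open scoped ComplexOrder MatrixOrder Kronecker

universe u v

namespace QExt

noncomputable section

/-! ### Operators on finite-dimensional systems

A system is given by a finite type `A` labelling an orthonormal basis of its Hilbert space `ℂ^A`;
the composite of the systems `A` and `B` is `A × B`, and operators are square complex matrices. -/

variable {A B X Y C : Type*} [Fintype A] [DecidableEq A] [Fintype B] [DecidableEq B]
  [Fintype X] [DecidableEq X] [Fintype Y] [DecidableEq Y] [Fintype C] [DecidableEq C]

/-- Density operators: positive semidefinite with trace one. -/
def IsDensity (ρ : Matrix A A ℂ) : Prop := ρ.PosSemidef ∧ ρ.trace = 1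

/-- The rank one projector `[v] = |v⟩⟨v|` on a basis vector. -/
def proj (v : A) : Matrix A A ℂ := Matrix.single v v 1

/-- The maximally mixed state `1 / dim`. -/
def maxMixed (A : Type*) [Fintype A] [DecidableEq A] : Matrix A A ℂ :=
  (Fintype.card A : ℂ)⁻¹ • (1 : Matrix A A ℂ)

/-- The trace norm `tr |S|`, where `|S| = √(S† S)`. -/
def traceNorm (S : Matrix A A ℂ) : ℝ := (CFC.sqrt (S.conjTranspose * S)).trace.re

/-- The trace distance `½ ‖ρ - σ‖₁`. -/
def traceDist (ρ σ : Matrix A A ℂ) : ℝ := 1 / 2 * traceNorm (ρ - σ)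

/-- The operator `ρ_{B ∧ x} = (⟨x| ⊗ 1) ρ (|x⟩ ⊗ 1)` on `B`, the subnormalized conditional state. -/
def condOp (ρ : Matrix (X × B) (X × B) ℂ) (x : X) : Matrix B B ℂ :=
  Matrix.of fun b b' => ρ (x, b) (x, b')

/-- `ρ_{XB}` is classical on `X` : `ρ_{XB} = ∑ x, [x] ⊗ ρ_{B ∧ x}`. -/
def IsCQ (ρ : Matrix (X × B) (X × B) ℂ) : Prop :=
  ρ = ∑ x : X, proj x ⊗ₖ condOp ρ x

/-- The min-entropy of `ρ_{AB}` relative to `σ_B`, i.e. the supremum of all real `z` with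
`ρ_{AB} ≤ 2^{-z} 1_A ⊗ σ_B`. For positive operators there is no such `z`, and the value is `-∞`, exactly if the kernel of
`1_A ⊗ σ_B` is not contained in that of `ρ_{AB}`. -/
def minEntropyRel (ρ : Matrix (A × B) (A × B) ℂ) (σ : Matrix B B ℂ) : EReal :=
  sSup {h : EReal | ∃ z : ℝ, h = (z : EReal) ∧
    ((((2 : ℝ) ^ (-z) : ℝ) : ℂ) • ((1 : Matrix A A ℂ) ⊗ₖ σ) - ρ).PosSemidef}

/-- The conditional min-entropy `H_min(A|B)_ρ`. -/
def minEntropy (ρ : Matrix (A × B) (A × B) ℂ) : EReal :=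
  ⨆ (σ : Matrix B B ℂ) (_ : IsDensity σ), minEntropyRel ρ σ

/-! ### Two sources with side information -/

variable {X₁ X₂ C₁ C₂ Z : Type*} [Fintype X₁] [DecidableEq X₁] [Fintype X₂] [DecidableEq X₂]
  [Fintype C₁] [DecidableEq C₁] [Fintype C₂] [DecidableEq C₂] [Fintype Z] [DecidableEq Z]

/-- `ρ_{X₁X₂C₁C₂} = ρ_{X₁C₁} ⊗ ρ_{X₂C₂}`, with the systems reordered as `(X₁X₂)(C₁C₂)`. -/
def productState (ρ₁ : Matrix (X₁ × C₁) (X₁ × C₁) ℂ) (ρ₂ : Matrix (X₂ × C₂) (X₂ × C₂) ℂ) :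
    Matrix ((X₁ × X₂) × (C₁ × C₂)) ((X₁ × X₂) × (C₁ × C₂)) ℂ :=
  Matrix.reindex (Equiv.prodProdProdComm X₁ C₁ X₂ C₂) (Equiv.prodProdProdComm X₁ C₁ X₂ C₂)
    (ρ₁ ⊗ₖ ρ₂)

/-- The marginal `ρ_{X₁C}` of `ρ_{X₁X₂C}` : the partial trace over `X₂`. -/
def marginalX₁C (ρ : Matrix ((X₁ × X₂) × C) ((X₁ × X₂) × C) ℂ) :
    Matrix (X₁ × C) (X₁ × C) ℂ :=
  Matrix.of fun a b => ∑ x₂ : X₂, ρ ((a.1, x₂), a.2) ((b.1, x₂), b.2)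

/-- The state `ρ_{f(X₁,X₂) X₁ C}`, in which the second register is a copy of `X₁` :
`∑ x₁ x₂, [f(x₁,x₂)] ⊗ [x₁] ⊗ ρ_{C ∧ x₁,x₂}`. -/
def outputStateX₁ (f : X₁ → X₂ → Z) (ρ : Matrix ((X₁ × X₂) × C) ((X₁ × X₂) × C) ℂ) :
    Matrix (Z × (X₁ × C)) (Z × (X₁ × C)) ℂ :=
  ∑ x₁ : X₁, ∑ x₂ : X₂, proj (f x₁ x₂) ⊗ₖ (proj x₁ ⊗ₖ condOp ρ (x₁, x₂))

end

/-- Bit strings of length `n`, as vectors over the field with two elements. -/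
abbrev Bits (n : ℕ) : Type := Fin n → ZMod 2

/-- `Ext` is a `(k₁, k₂, ε)` `X₁`-strong two-source extractor against quantum product-type
knowledge. -/
def IsX₁StrongQuantumProductExtractor {n₁ n₂ m : ℕ} (Ext : Bits n₁ → Bits n₂ → Bits m)
    (k₁ k₂ ε : ℝ) : Prop :=
  ∀ (C₁ : Type u) (C₂ : Type v) [Fintype C₁] [DecidableEq C₁] [Fintype C₂] [DecidableEq C₂]
    (ρ₁ : Matrix (Bits n₁ × C₁) (Bits n₁ × C₁) ℂ) (ρ₂ : Matrix (Bits n₂ × C₂) (Bits n₂ × C₂) ℂ),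
    IsDensity ρ₁ → IsCQ ρ₁ → IsDensity ρ₂ → IsCQ ρ₂ →
    (k₁ : EReal) ≤ minEntropy ρ₁ → (k₂ : EReal) ≤ minEntropy ρ₂ →
    traceDist (outputStateX₁ Ext (productState ρ₁ ρ₂))
      (maxMixed (Bits m) ⊗ₖ marginalX₁C (productState ρ₁ ρ₂)) ≤ ε

open scoped Matrix in
/-- The function `deor_𝒜(x, y) = ((A₁ x) · y, …, (A_m x) · y)`, inner products modulo 2. -/
def deor {n m : ℕ} (𝒜 : Fin m → Matrix (Fin n) (Fin n) (ZMod 2)) (x y : Bits n) : Bits m :=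
  fun i => (𝒜 i *ᵥ x) ⬝ᵥ y

end QExt

namespace QExt

/-! Since the output keeps X₁, the difference of the two states is block diagonal in z and x, and
`traceDist_outputStateX₁_eq` turns the distance into D/2. Here D averages ∑_z ‖Δ_{x,z}‖₁ over the
law P of X₁, and Δ_{x,z} is the defect of the output z on C₂. With σ from the min-entropy of X₂,
`two_mul_traceNorm_le` bounds each trace norm by tr σ and tr(σ^{-1/2} Δ σ^{-1/2} Δ). These quadratic
terms are nonnegative, so P(x) may be replaced by 2^{-k₁} and x summed freely. Expanding over pairs
y, y' leaves a kernel K(y - y'), because deor is linear in its second argument. By characters, K(d)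
is 2^{n-m} times the number of nonzero s with A_sᵀ d = 0. Hence K ≥ 0, and the rank hypothesis
bounds its total mass by 2^{n-m}(2^m - 1)2^r. With ρ_y ≤ 2^{-k₂}σ this gives D² ≤ 2^{n+r-k₁-k₂}(2^m
- 1). The stated error follows from this or from the trivial bound D ≤ 2. -/

theorem proj_conjTranspose {A : Type*} [DecidableEq A] (a : A) : (proj a).conjTranspose = proj a := by
  simp [proj]

theorem sum_proj_kronecker_mul {A B : Type*} [Fintype A] [DecidableEq A] [Fintype B]
    (F G : A → Matrix B B ℂ) :
    (∑ a, proj a ⊗ₖ F a) * (∑ a, proj a ⊗ₖ G a) = ∑ a, proj a ⊗ₖ (F a * G a) := by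
  rw [Finset.sum_mul_sum]
  refine Finset.sum_congr rfl fun a _ => ?_
  rw [Finset.sum_eq_single a]
  · rw [← Matrix.mul_kronecker_mul, proj, Matrix.single_mul_single_same, one_mul]
  · intro b _ hb
    rw [← Matrix.mul_kronecker_mul, proj, proj, Matrix.single_mul_single_of_ne _ _ _ _ hb.symm,
      Matrix.zero_kronecker]
  · simp

/-! ### Trace norm: block structure and inequalities -/

section TraceNorm

variable {A B : Type*} [Fintype A] [DecidableEq A] [Fintype B] [DecidableEq B]

theorem trace_mul_re_nonneg {P Q : Matrix A A ℂ} (hP : P.PosSemidef) (hQ : Q.PosSemidef) :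
    0 ≤ (P * Q).trace.re := by
  have hs : (CFC.sqrt P).IsHermitian := (Matrix.nonneg_iff_posSemidef.1 (CFC.sqrt_nonneg P)).1
  have h : (P * Q).trace = (CFC.sqrt P * Q * (CFC.sqrt P).conjTranspose).trace := by
    rw [hs.eq, Matrix.trace_mul_comm (CFC.sqrt P * Q), ← Matrix.mul_assoc,
      CFC.sqrt_mul_sqrt_self P (Matrix.nonneg_iff_posSemidef.2 hP)]
  rw [h]
  exact (Complex.nonneg_iff.1 (hQ.mul_mul_conjTranspose_same _).trace_nonneg).1

theorem traceNorm_nonneg (D : Matrix A A ℂ) : 0 ≤ traceNorm D :=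
  (Complex.nonneg_iff.1 (Matrix.nonneg_iff_posSemidef.1 (CFC.sqrt_nonneg _)).trace_nonneg).1

theorem exists_sign_trace_eq_traceNorm {D : Matrix A A ℂ} (hD : D.IsHermitian) :
    ∃ U : Matrix A A ℂ, U.IsHermitian ∧ U * U = 1 ∧ (U * D).trace.re = traceNorm D := by
  have hc : ∀ f : ℝ → ℝ, ContinuousOn f (spectrum ℝ D) :=
    fun f => (Matrix.finite_real_spectrum (A := D)).continuousOn f
  -- The value 1 at 0, where the usual sign vanishes, makes `cfc f D` an involution.
  let f : ℝ → ℝ := fun x => if 0 ≤ x then 1 else -1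
  have hU : IsSelfAdjoint (cfc f D) := cfc_predicate f D
  refine ⟨cfc f D, hU, ?_, ?_⟩
  · rw [← cfc_mul f f D (hc _) (hc _), ← cfc_one ℝ D]
    congr 1
    funext x
    simp only [f]
    split_ifs <;> simp
  · have h1 : cfc f D * D = cfc (fun x : ℝ => |x|) D := by
      nth_rewrite 2 [← cfc_id ℝ D]
      rw [← cfc_mul f id D (hc _) (hc _)]
      congr 1
      funext x
      simp only [f, id]
      split_ifs with h
      · simp [abs_of_nonneg h]
      · simp [abs_of_neg (not_le.1 h)]
    have h2 : CFC.sqrt (D.conjTranspose * D) = cfc (fun x : ℝ => |x|) D := by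
      refine CFC.sqrt_unique ?_ (cfc_nonneg fun x _ => abs_nonneg x)
      have hDD : D * D = cfc (fun x : ℝ => x * x) D := by
        rw [cfc_mul (fun x => x) (fun x => x) D (hc _) (hc _), cfc_id' ℝ D]
      rw [← cfc_mul _ _ D (hc _) (hc _), hD.eq, hDD]
      congr 1
      funext x
      exact abs_mul_abs_self x
    rw [traceNorm, h2, h1]

theorem traceNorm_posSemidef_kronecker {P : Matrix A A ℂ} (hP : P.PosSemidef) (D : Matrix B B ℂ) :
    traceNorm (P ⊗ₖ D) = P.trace.re * traceNorm D := by
  have hN : (CFC.sqrt (D.conjTranspose * D)).PosSemidef :=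
    Matrix.nonneg_iff_posSemidef.1 (CFC.sqrt_nonneg _)
  have hs : CFC.sqrt ((P ⊗ₖ D).conjTranspose * (P ⊗ₖ D))
      = P ⊗ₖ CFC.sqrt (D.conjTranspose * D) := by
    refine CFC.sqrt_unique ?_ (Matrix.nonneg_iff_posSemidef.2 (hP.kronecker hN))
    rw [← Matrix.mul_kronecker_mul, CFC.sqrt_mul_sqrt_self _
      (Matrix.nonneg_iff_posSemidef.2 (Matrix.posSemidef_conjTranspose_mul_self D)),
      Matrix.conjTranspose_kronecker, ← Matrix.mul_kronecker_mul, hP.1.eq]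
  rw [traceNorm, traceNorm, hs, Matrix.trace_kronecker, Complex.mul_re,
    ← (Complex.nonneg_iff.1 hP.trace_nonneg).2, zero_mul, sub_zero]

theorem proj_posSemidef (a : A) : (proj a).PosSemidef := by
  have h := Matrix.posSemidef_conjTranspose_mul_self (proj a)
  rwa [proj_conjTranspose, proj, Matrix.single_mul_single_same, one_mul] at h

theorem traceNorm_sum_proj_kronecker (F : A → Matrix B B ℂ) :
    traceNorm (∑ a, proj a ⊗ₖ F a) = ∑ a, traceNorm (F a) := by
  have hs : CFC.sqrt ((∑ a, proj a ⊗ₖ F a).conjTranspose * (∑ a, proj a ⊗ₖ F a))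
      = ∑ a, proj a ⊗ₖ CFC.sqrt ((F a).conjTranspose * F a) := by
    refine CFC.sqrt_unique ?_ (Matrix.nonneg_iff_posSemidef.2 ?_)
    · rw [sum_proj_kronecker_mul, Matrix.conjTranspose_sum]
      simp_rw [Matrix.conjTranspose_kronecker, proj_conjTranspose]
      rw [sum_proj_kronecker_mul]
      refine Finset.sum_congr rfl fun a _ => ?_
      rw [CFC.sqrt_mul_sqrt_self _
        (Matrix.nonneg_iff_posSemidef.2 (Matrix.posSemidef_conjTranspose_mul_self _))]
    · exact Matrix.posSemidef_sum _ fun a _ =>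
        (proj_posSemidef a).kronecker (Matrix.nonneg_iff_posSemidef.1 (CFC.sqrt_nonneg _))
  rw [traceNorm, hs, Matrix.trace_sum, Complex.re_sum]
  refine Finset.sum_congr rfl fun a _ => ?_
  rw [Matrix.trace_kronecker, proj, Matrix.trace_single_eq_same, one_mul, traceNorm]

/-- A weighted Cauchy–Schwarz bound on the trace norm by a Hilbert–Schmidt norm. -/
theorem two_mul_traceNorm_le {D S T : Matrix A A ℂ} (hD : D.IsHermitian) (hS : S.PosSemidef)
    (hT : T.IsHermitian) (hST : S * T = 1) (t : ℝ) :
    2 * t * traceNorm D ≤ t ^ 2 * (S * S).trace.re + (T * D * (T * D)).trace.re := by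
  obtain ⟨U, hU, hUU, hUD⟩ := exists_sign_trace_eq_traceNorm hD
  have hTS : T * S = 1 := mul_eq_one_comm.1 hST
  -- The commutator of U and S has nonnegative Hilbert–Schmidt norm.
  have ha : (U * S * (U * S)).trace.re ≤ (S * S).trace.re := by
    have h := (Complex.nonneg_iff.1
      (Matrix.posSemidef_conjTranspose_mul_self (U * S - S * U)).trace_nonneg).1
    have e : ((U * S - S * U).conjTranspose * (U * S - S * U)).trace
        = 2 * (S * S).trace - 2 * (U * S * (U * S)).trace := by
      rw [Matrix.conjTranspose_sub, Matrix.conjTranspose_mul, Matrix.conjTranspose_mul, hU.eq,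
        hS.1.eq]
      have e1 : (S * U - U * S) * (U * S - S * U)
          = S * (U * U) * S - S * U * S * U - U * S * U * S + U * (S * S) * U := by noncomm_ring
      have e2 : (U * (S * S) * U).trace = (S * S).trace := by
        rw [Matrix.trace_mul_comm, ← Matrix.mul_assoc, hUU, Matrix.one_mul]
      have e3 : (S * U * S * U).trace = (U * S * (U * S)).trace := by
        rw [Matrix.trace_mul_comm]; simp only [Matrix.mul_assoc]
      rw [e1, Matrix.trace_add, Matrix.trace_sub, Matrix.trace_sub, e2, e3, hUU, Matrix.mul_one,
        Matrix.mul_assoc (U * S)]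
      ring
    rw [e] at h
    simp at h
    linarith
  have hM : ((t : ℂ) • U - T * D * T).IsHermitian := by
    rw [Matrix.IsHermitian, Matrix.conjTranspose_sub, Matrix.conjTranspose_smul,
      Matrix.conjTranspose_mul, Matrix.conjTranspose_mul, hU.eq, hT.eq, hD.eq, Matrix.mul_assoc]
    simp
  set M := (t : ℂ) • U - T * D * T with hMdef
  -- Expanding this square gives t² tr(USUS) - 2t tr(UD) + tr(TDTD), and tr(UD) is the trace norm of
  -- D.
  have hpos : 0 ≤ (M * S * M * S).trace.re := by
    have := hS.mul_mul_conjTranspose_same M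
    rw [hM.eq] at this
    exact trace_mul_re_nonneg this hS
  have hMS : M * S = (t : ℂ) • (U * S) - T * D := by
    rw [hMdef, Matrix.sub_mul, Matrix.mul_assoc (T * D), hTS, Matrix.mul_one, Matrix.smul_mul]
  have e4 : (U * S * (T * D)).trace = (U * D).trace := by
    rw [Matrix.mul_assoc, ← Matrix.mul_assoc S, hST, Matrix.one_mul]
  have e5 : (T * D * (U * S)).trace = (U * D).trace := by
    rw [Matrix.trace_mul_comm, e4]
  rw [Matrix.mul_assoc, hMS, Matrix.sub_mul, Matrix.mul_sub, Matrix.mul_sub] at hpos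
  simp only [Matrix.trace_sub, Matrix.smul_mul, Matrix.mul_smul, Matrix.trace_smul, e4, e5,
    smul_eq_mul, Complex.sub_re, Complex.re_ofReal_mul, hUD] at hpos
  nlinarith [mul_le_mul_of_nonneg_left ha (sq_nonneg t)]

theorem traceNorm_sum_smul_le {ι : Type*} [Fintype ι] (c : ι → ℝ) {ρ : ι → Matrix A A ℂ}
    (hρ : ∀ i, (ρ i).PosSemidef) :
    traceNorm (∑ i, (c i : ℂ) • ρ i) ≤ ∑ i, |c i| * (ρ i).trace.re := by
  have hH : (∑ i, (c i : ℂ) • ρ i).IsHermitian := by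
    rw [Matrix.IsHermitian, Matrix.conjTranspose_sum]
    refine Finset.sum_congr rfl fun i _ => ?_
    rw [Matrix.conjTranspose_smul, (hρ i).1.eq]
    simp
  obtain ⟨U, hU, hUU, hUD⟩ := exists_sign_trace_eq_traceNorm hH
  rw [← hUD, Matrix.mul_sum, Matrix.trace_sum, Complex.re_sum]
  refine Finset.sum_le_sum fun i _ => ?_
  -- An involution satisfies 1 + V = ½(1 + V)² ≥ 0; taking V = ±U gives |tr(Uρ)| ≤ tr ρ.
  have h1 : ∀ V : Matrix A A ℂ, V.IsHermitian → V * V = 1 → 0 ≤ ((1 + V) * ρ i).trace.re := by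
    intro V hV hVV
    refine trace_mul_re_nonneg ?_ (hρ i)
    have h := (Matrix.posSemidef_conjTranspose_mul_self (1 + V)).smul
      (show (0 : ℝ) ≤ 1 / 2 by norm_num)
    rw [Matrix.conjTranspose_add, hV.eq, Matrix.conjTranspose_one] at h
    have e : (1 / 2 : ℝ) • ((1 + V) * (1 + V)) = 1 + V := by
      rw [show (1 + V) * (1 + V) = 1 + V + V + V * V by noncomm_ring, hVV,
        show 1 + V + V + 1 = (2 : ℝ) • (1 + V) by rw [two_smul]; abel, smul_smul]
      norm_num
    rwa [e] at h
  have hp := h1 U hU hUU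
  have hm := h1 (-U) hU.neg (by rw [neg_mul_neg, hUU])
  rw [Matrix.add_mul, Matrix.one_mul, Matrix.trace_add, Complex.add_re] at hp hm
  rw [Matrix.neg_mul, Matrix.trace_neg, Complex.neg_re] at hm
  rw [Matrix.mul_smul, Matrix.trace_smul, smul_eq_mul, Complex.re_ofReal_mul]
  calc c i * (U * ρ i).trace.re ≤ |c i * (U * ρ i).trace.re| := le_abs_self _
    _ = |c i| * |(U * ρ i).trace.re| := abs_mul _ _
    _ ≤ _ := mul_le_mul_of_nonneg_left (abs_le.2 ⟨by linarith, by linarith⟩) (abs_nonneg _)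

end TraceNorm

/-! ### Characters and the collision kernel -/

open scoped Matrix

/-- The nontrivial real character of the field with two elements. -/
noncomputable def bitSign (a : ZMod 2) : ℝ := if a = 0 then 1 else -1

theorem bitSign_add_one (a : ZMod 2) : bitSign (a + 1) = -bitSign a := by
  have h : a = 0 ∨ a = 1 := by revert a; decide
  rcases h with rfl | rfl
  · simp [bitSign]
  · simp [bitSign, show (1 + 1 : ZMod 2) = 0 by decide]

/-- If v has a nonzero coordinate, translating x by that basis vector flips every sign, so the sum
equals its own negative. -/
theorem sum_bitSign_dotProduct {n : ℕ} (v : Bits n) :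
    ∑ x : Bits n, bitSign (v ⬝ᵥ x) = if v = 0 then (2 : ℝ) ^ n else 0 := by
  split_ifs with h
  · simp [h, bitSign]
  · obtain ⟨i, hi⟩ := Function.ne_iff.1 h
    have hi1 : v i = 1 := by
      have : ∀ a : ZMod 2, a ≠ 0 → a = 1 := by decide
      exact this _ hi
    have e := Equiv.sum_comp (Equiv.addRight (Pi.single i 1 : Bits n))
      (fun x => bitSign (v ⬝ᵥ x))
    simp only [Equiv.coe_addRight, dotProduct_add, dotProduct_single, hi1, mul_one,
      bitSign_add_one, Finset.sum_neg_distrib] at e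
    linarith

variable {n m : ℕ}

theorem deor_sub_right (𝒜 : Fin m → Matrix (Fin n) (Fin n) (ZMod 2)) (x y y' : Bits n) :
    deor 𝒜 x (y - y') = deor 𝒜 x y - deor 𝒜 x y' := by
  funext i
  simp [deor, dotProduct_sub]

theorem deor_dotProduct (𝒜 : Fin m → Matrix (Fin n) (Fin n) (ZMod 2)) (x d : Bits n)
    (s : Bits m) :
    deor 𝒜 x d ⬝ᵥ s = ((∑ i, s i • 𝒜 i)ᵀ *ᵥ d) ⬝ᵥ x := by
  rw [Matrix.mulVec_transpose, ← Matrix.dotProduct_mulVec, Matrix.sum_mulVec, dotProduct_sum]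
  simp only [dotProduct, deor, Matrix.smul_mulVec, Pi.smul_apply, smul_eq_mul]
  refine Finset.sum_congr rfl fun i _ => ?_
  rw [Finset.sum_mul]
  exact Finset.sum_congr rfl fun j _ => by ring

/-- The bias of the event `deor x d = 0` for uniform `x`, as a count of the nontrivial
combinations of the matrices whose transpose annihilates `d`. -/
theorem sum_deor_eq_zero_sub (𝒜 : Fin m → Matrix (Fin n) (Fin n) (ZMod 2)) (d : Bits n) :
    ∑ x : Bits n, ((if deor 𝒜 x d = 0 then (1 : ℝ) else 0) - ((2 : ℝ) ^ m)⁻¹)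
      = ((2 : ℝ) ^ m)⁻¹ * 2 ^ n *
        ∑ s ∈ Finset.univ.erase (0 : Bits m),
          if (∑ i, s i • 𝒜 i)ᵀ *ᵥ d = 0 then (1 : ℝ) else 0 := by
  -- Fourier expansion of the indicator of 0 over all s.
  have h1 : ∀ x : Bits n, (if deor 𝒜 x d = 0 then (1 : ℝ) else 0)
      = ((2 : ℝ) ^ m)⁻¹ * ∑ s : Bits m, bitSign (((∑ i, s i • 𝒜 i)ᵀ *ᵥ d) ⬝ᵥ x) := by
    intro x
    simp_rw [← deor_dotProduct]
    rw [sum_bitSign_dotProduct]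
    split_ifs <;> simp
  simp_rw [h1]
  rw [Finset.sum_sub_distrib, ← Finset.mul_sum, Finset.sum_comm]
  simp_rw [sum_bitSign_dotProduct]
  -- The term s = 0 always contributes 2^n and cancels the subtracted mean.
  have h2 : ∑ s : Bits m, (if (∑ i, s i • 𝒜 i)ᵀ *ᵥ d = 0 then (2 : ℝ) ^ n else 0)
      = 2 ^ n + 2 ^ n * ∑ s ∈ Finset.univ.erase (0 : Bits m),
          if (∑ i, s i • 𝒜 i)ᵀ *ᵥ d = 0 then (1 : ℝ) else 0 := by
    rw [← Finset.add_sum_erase _ _ (Finset.mem_univ (0 : Bits m)), Finset.mul_sum]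
    simp only [mul_ite, mul_one, mul_zero]
    congr 1
    simp
  rw [h2, Finset.sum_const, Finset.card_univ, Fintype.card_fun, ZMod.card, Fintype.card_fin,
    nsmul_eq_mul]
  push_cast
  ring

theorem card_ker_transpose_le {r : ℕ} (M : Matrix (Fin n) (Fin n) (ZMod 2))
    (hM : (n : ℤ) - (r : ℤ) ≤ (M.rank : ℤ)) :
    (∑ d : Bits n, if Mᵀ *ᵥ d = 0 then (1 : ℝ) else 0) ≤ 2 ^ r := by
  have hr := LinearMap.finrank_range_add_finrank_ker Mᵀ.mulVecLin
  change Mᵀ.rank + _ = _ at hr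
  rw [Matrix.rank_transpose, Module.finrank_fin_fun] at hr
  have hle : Module.finrank (ZMod 2) (LinearMap.ker Mᵀ.mulVecLin) ≤ r := by omega
  classical
  have hc := Module.card_eq_pow_finrank (K := ZMod 2) (V := LinearMap.ker Mᵀ.mulVecLin)
  rw [ZMod.card] at hc
  have hc' : (Finset.univ.filter fun d : Bits n => Mᵀ *ᵥ d = 0).card
      = Fintype.card (LinearMap.ker Mᵀ.mulVecLin) := by
    rw [← Fintype.card_subtype]
    exact Fintype.card_congr (Equiv.refl _)
  rw [Finset.sum_boole, hc', hc]
  exact_mod_cast Nat.pow_le_pow_right (by norm_num) hle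

theorem sum_sum_deor_eq_zero_sub_le {r : ℕ} (𝒜 : Fin m → Matrix (Fin n) (Fin n) (ZMod 2))
    (h𝒜 : ∀ s : Fin m → ZMod 2, s ≠ 0 → (n : ℤ) - (r : ℤ) ≤ ((∑ i, s i • 𝒜 i).rank : ℤ)) :
    ∑ d : Bits n, ∑ x : Bits n, ((if deor 𝒜 x d = 0 then (1 : ℝ) else 0) - ((2 : ℝ) ^ m)⁻¹)
      ≤ ((2 : ℝ) ^ m)⁻¹ * 2 ^ n * ((2 ^ m - 1) * 2 ^ r) := by
  simp_rw [sum_deor_eq_zero_sub]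
  rw [← Finset.mul_sum, Finset.sum_comm]
  refine mul_le_mul_of_nonneg_left ?_ (by positivity)
  calc _ ≤ ∑ s ∈ Finset.univ.erase (0 : Bits m), (2 : ℝ) ^ r :=
        Finset.sum_le_sum fun s hs => card_ker_transpose_le _ (h𝒜 s (Finset.ne_of_mem_erase hs))
    _ = (2 ^ m - 1) * 2 ^ r := by
        rw [Finset.sum_const, Finset.card_erase_of_mem (Finset.mem_univ _), nsmul_eq_mul,
          Nat.cast_sub (by simp [Nat.one_le_pow])]
        simp

/-- The covariance of the output indicator functions. -/
theorem sum_indicator_sub_mul {Z : Type*} [Fintype Z] [DecidableEq Z] [Nonempty Z] (w w' : Z) :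
    ∑ z : Z, ((if w = z then (1 : ℝ) else 0) - (Fintype.card Z : ℝ)⁻¹)
        * ((if w' = z then (1 : ℝ) else 0) - (Fintype.card Z : ℝ)⁻¹)
      = (if w = w' then 1 else 0) - (Fintype.card Z : ℝ)⁻¹ := by
  have hc : (Fintype.card Z : ℝ) ≠ 0 := by simp
  simp only [sub_mul, mul_sub, Finset.sum_sub_distrib, ite_mul, mul_ite, one_mul, mul_one,
    zero_mul, mul_zero, Finset.sum_ite_eq, Finset.mem_univ, if_true, Finset.sum_const,
    Finset.card_univ, nsmul_eq_mul]
  rw [mul_inv_cancel_left₀ hc]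
  simp

/-! ### Consequences of conditional min-entropy -/

theorem exists_density_of_lt_minEntropy {A B : Type*} [DecidableEq A] [Fintype B]
    {ρ : Matrix (A × B) (A × B) ℂ} {k z : ℝ}
    (hk : (k : EReal) ≤ minEntropy ρ) (hz : z < k) :
    ∃ σ : Matrix B B ℂ, IsDensity σ ∧
      ∀ x, ((((2 : ℝ) ^ (-z) : ℝ) : ℂ) • σ - condOp ρ x).PosSemidef := by
  have h : (z : EReal) < minEntropy ρ := (EReal.coe_lt_coe_iff.2 hz).trans_le hk
  simp only [minEntropy, lt_iSup_iff, minEntropyRel, lt_sSup_iff] at h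
  obtain ⟨σ, hσ, _, ⟨w, rfl, hw⟩, hzw⟩ := h
  have hzw' : z < w := EReal.coe_lt_coe_iff.1 hzw
  refine ⟨σ, hσ, fun x => ?_⟩
  have h1 := hw.submatrix fun b : B => (x, b)
  have h2 : (((2 : ℝ) ^ (-z) - (2 : ℝ) ^ (-w) : ℝ) • σ).PosSemidef :=
    hσ.1.smul (sub_nonneg.2 (Real.rpow_le_rpow_of_exponent_le (by norm_num) (by linarith)))
  convert h2.add h1 using 1
  ext i j
  simp [condOp]
  ring

/-- The gap between z and k pays for mixing σ with the maximally mixed state, which makes its square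
root invertible. -/
theorem exists_posDef_of_lt_minEntropy {A B : Type*} [DecidableEq A] [Fintype B]
    [DecidableEq B] {ρ : Matrix (A × B) (A × B) ℂ} {k z : ℝ}
    (hk : (k : EReal) ≤ minEntropy ρ) (hz : z < k) :
    ∃ σ : Matrix B B ℂ, σ.PosDef ∧ σ.trace = 1 ∧
      ∀ x, ((((2 : ℝ) ^ (-z) : ℝ) : ℂ) • σ - condOp ρ x).PosSemidef := by
  obtain ⟨w, hzw, hwk⟩ := exists_between hz
  obtain ⟨σ, hσ, h⟩ := exists_density_of_lt_minEntropy hk hwk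
  have hlt : (2 : ℝ) ^ (-w) < (2 : ℝ) ^ (-z) :=
    Real.rpow_lt_rpow_of_exponent_lt (by norm_num) (by linarith)
  have hw0 : (0 : ℝ) < (2 : ℝ) ^ (-w) := by positivity
  have hz0 : (0 : ℝ) < (2 : ℝ) ^ (-z) := by positivity
  have hB : (0 : ℝ) < Fintype.card B := by
    rw [Nat.cast_pos, Fintype.card_pos_iff]
    by_contra hB
    rw [not_nonempty_iff] at hB
    simpa [Matrix.trace] using hσ.2
  set a : ℝ := (2 : ℝ) ^ (-w)
  set l : ℝ := (2 : ℝ) ^ (-z)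
  have hμ : 0 < (l - a) / l / Fintype.card B := by
    have := sub_pos.2 hlt
    positivity
  have hd : ((((l - a) / l / Fintype.card B : ℝ)) • (1 : Matrix B B ℂ)).PosDef :=
    Matrix.PosDef.one.smul hμ
  refine ⟨(a / l) • σ + ((l - a) / l / Fintype.card B : ℝ) • (1 : Matrix B B ℂ),
    hd.posSemidef_add (hσ.1.smul (by positivity)), ?_, fun x => ?_⟩
  · rw [Matrix.trace_add, Matrix.trace_smul, Matrix.trace_smul, hσ.2, Matrix.trace_one]
    have hB' : (Fintype.card B : ℂ) ≠ 0 := by exact_mod_cast hB.ne'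
    have hl' : (l : ℂ) ≠ 0 := by exact_mod_cast hz0.ne'
    simp only [Complex.real_smul]
    push_cast
    field_simp
    ring
  · convert (h x).add (hd.posSemidef.smul hz0.le) using 1
    have hl' : (l : ℂ) ≠ 0 := by exact_mod_cast hz0.ne'
    ext i j
    simp
    field_simp
    ring

theorem condOp_posSemidef {A B : Type*} {ρ : Matrix (A × B) (A × B) ℂ} (hρ : ρ.PosSemidef) (x : A) :
    (condOp ρ x).PosSemidef :=
  hρ.submatrix fun b : B => (x, b)

theorem sum_trace_condOp {A B : Type*} [Fintype A] [Fintype B]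
    {ρ : Matrix (A × B) (A × B) ℂ} (hρ : IsDensity ρ) :
    ∑ x, (condOp ρ x).trace.re = 1 := by
  rw [← Complex.re_sum, ← Complex.one_re, ← hρ.2]
  congr 1
  simp [Matrix.trace, condOp, Fintype.sum_prod_type]

theorem le_mul_two_rpow_neg {a b k : ℝ} (h : ∀ z < k, a ≤ b * (2 : ℝ) ^ (-z)) :
    a ≤ b * (2 : ℝ) ^ (-k) := by
  have hc : Continuous fun z : ℝ => b * (2 : ℝ) ^ (-z) :=
    continuous_const.mul (continuous_const.rpow continuous_neg fun _ => Or.inl (by norm_num))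
  refine ge_of_tendsto (hc.continuousWithinAt (s := Set.Iio k) (x := k)) ?_
  filter_upwards [self_mem_nhdsWithin] with z hz using h z hz

theorem trace_condOp_le {A B : Type*} [DecidableEq A] [Fintype B] {ρ : Matrix (A × B) (A × B) ℂ} {k : ℝ}
    (hk : (k : EReal) ≤ minEntropy ρ) (x : A) : (condOp ρ x).trace.re ≤ (2 : ℝ) ^ (-k) := by
  rw [← one_mul ((2 : ℝ) ^ (-k))]
  refine le_mul_two_rpow_neg fun z hz => ?_
  obtain ⟨σ, hσ, h⟩ := exists_density_of_lt_minEntropy hk hz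
  have := (Complex.nonneg_iff.1 (h x).trace_nonneg).1
  rw [Matrix.trace_sub, Matrix.trace_smul, hσ.2] at this
  simp only [smul_eq_mul, mul_one, Complex.sub_re, Complex.ofReal_re] at this
  linarith

/-! ### Reduction to the defects of the output -/

/-- The difference between the conditional operators of the output `z` of the map `f` applied to a
classical-quantum source and those of a uniform output. -/
noncomputable def outputDefect {X₂ C₂ Z : Type*} [Fintype X₂] [Fintype Z] [DecidableEq Z]
    (f : X₂ → Z) (ρ : X₂ → Matrix C₂ C₂ ℂ) (z : Z) : Matrix C₂ C₂ ℂ :=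
  ∑ y, (((if f y = z then (1 : ℝ) else 0) - (Fintype.card Z : ℝ)⁻¹ : ℝ) : ℂ) • ρ y

/-- Classicality matters only for ρ₁: the marginal retains X₁, whose off-diagonal blocks must
vanish, whereas X₂ is traced out. -/
theorem outputStateX₁_sub_eq {X₁ X₂ C₁ C₂ Z : Type*} [Fintype X₁] [DecidableEq X₁]
    [Fintype X₂] [Fintype Z] [DecidableEq Z] (f : X₁ → X₂ → Z) {ρ₁ : Matrix (X₁ × C₁) (X₁ × C₁) ℂ}
    (ρ₂ : Matrix (X₂ × C₂) (X₂ × C₂) ℂ) (h₁ : IsCQ ρ₁) :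
    outputStateX₁ f (productState ρ₁ ρ₂) - maxMixed Z ⊗ₖ marginalX₁C (productState ρ₁ ρ₂)
      = ∑ z, proj z ⊗ₖ ∑ x, proj x ⊗ₖ (condOp ρ₁ x ⊗ₖ outputDefect (f x) (condOp ρ₂) z) := by
  ext ⟨z, x, c, d⟩ ⟨z', x', c', d'⟩
  have e : ρ₁ (x, c) (x', c') = if x = x' then ρ₁ (x, c) (x, c') else 0 := by
    have := congr_fun (congr_fun h₁ (x, c)) (x', c')
    rw [this]
    simp [Matrix.sum_apply, proj, Matrix.single_apply, condOp, ite_and]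
  have e1 : outputStateX₁ f (productState ρ₁ ρ₂) (z, x, c, d) (z', x', c', d')
      = if z = z' then if x = x' then
          ρ₁ (x, c) (x, c') * ∑ y, (if f x y = z then 1 else 0) * ρ₂ (y, d) (y, d')
        else 0 else 0 := by
    simp only [outputStateX₁, productState, Matrix.sum_apply, Matrix.kroneckerMap_apply, proj,
      Matrix.single_apply, condOp, Matrix.of_apply, Matrix.reindex_apply, Matrix.submatrix_apply]
    split_ifs with hz hx
    · subst hz hx
      rw [Finset.sum_eq_single x (fun b _ hb => by simp [hb]) (by simp), Finset.mul_sum]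
      refine Finset.sum_congr rfl fun y _ => ?_
      simp [Equiv.prodProdProdComm]
    · exact Finset.sum_eq_zero fun a _ => Finset.sum_eq_zero fun b _ => by
        rw [if_neg (fun h : a = x ∧ a = x' => hx (h.1.symm.trans h.2)), zero_mul, mul_zero]
    · exact Finset.sum_eq_zero fun a _ => Finset.sum_eq_zero fun b _ => by
        rw [if_neg (fun h => hz (h.1.symm.trans h.2)), zero_mul]
  have e2 : (maxMixed Z ⊗ₖ marginalX₁C (productState ρ₁ ρ₂)) (z, x, c, d) (z', x', c', d')
      = if z = z' then if x = x' then
          ρ₁ (x, c) (x, c') * ∑ y, (Fintype.card Z : ℂ)⁻¹ * ρ₂ (y, d) (y, d')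
        else 0 else 0 := by
    simp only [maxMixed, marginalX₁C, productState, Matrix.kroneckerMap_apply,
      Matrix.of_apply, Matrix.reindex_apply, Matrix.submatrix_apply]
    simp only [Equiv.prodProdProdComm, Equiv.coe_fn_symm_mk]
    rw [e, Matrix.smul_apply, Matrix.one_apply]
    split_ifs
    · simp only [Finset.mul_sum, smul_eq_mul]
      exact Finset.sum_congr rfl fun y _ => by ring
    · simp
    · simp
    · simp
  have e3 : (∑ z, proj z ⊗ₖ ∑ x, proj x ⊗ₖ (condOp ρ₁ x ⊗ₖ outputDefect (f x) (condOp ρ₂) z))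
      (z, x, c, d) (z', x', c', d')
      = if z = z' then if x = x' then
          ρ₁ (x, c) (x, c') * ∑ y, ((if f x y = z then 1 else 0) - (Fintype.card Z : ℂ)⁻¹)
            * ρ₂ (y, d) (y, d')
        else 0 else 0 := by
    simp only [Matrix.sum_apply, Matrix.kroneckerMap_apply, proj, outputDefect,
      Matrix.single_apply, condOp, Matrix.of_apply]
    split_ifs with hz hx
    · subst hz hx
      rw [Finset.sum_eq_single z (fun b _ hb => by simp [hb]) (by simp),
        Finset.sum_eq_single x (fun b _ hb => by simp [hb]) (by simp)]
      simp [apply_ite]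
    · rw [Finset.sum_eq_single z (fun b _ hb => by simp [hb]) (by simp)]
      rw [Finset.sum_eq_zero fun a _ => by
        rw [if_neg (fun h : a = x ∧ a = x' => hx (h.1.symm.trans h.2)), zero_mul], mul_zero]
    · exact Finset.sum_eq_zero fun a _ => by
        rw [if_neg (fun h => hz (h.1.symm.trans h.2)), zero_mul]
  rw [Matrix.sub_apply, e1, e2, e3]
  split_ifs
  · rw [← mul_sub, ← Finset.sum_sub_distrib]
    simp_rw [sub_mul]
  · simp
  · simp

theorem traceDist_outputStateX₁_eq {X₁ X₂ C₁ C₂ Z : Type*} [Fintype X₁] [DecidableEq X₁]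
    [Fintype X₂] [Fintype C₁] [DecidableEq C₁] [Fintype C₂] [DecidableEq C₂]
    [Fintype Z] [DecidableEq Z] (f : X₁ → X₂ → Z) {ρ₁ : Matrix (X₁ × C₁) (X₁ × C₁) ℂ}
    (ρ₂ : Matrix (X₂ × C₂) (X₂ × C₂) ℂ) (h₁ : IsCQ ρ₁) (hp : ρ₁.PosSemidef) :
    traceDist (outputStateX₁ f (productState ρ₁ ρ₂))
      (maxMixed Z ⊗ₖ marginalX₁C (productState ρ₁ ρ₂))
      = 1 / 2 * ∑ x, (condOp ρ₁ x).trace.re *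
          ∑ z, traceNorm (outputDefect (f x) (condOp ρ₂) z) := by
  rw [traceDist, outputStateX₁_sub_eq f ρ₂ h₁, traceNorm_sum_proj_kronecker]
  simp_rw [traceNorm_sum_proj_kronecker,
    traceNorm_posSemidef_kronecker (condOp_posSemidef hp _)]
  rw [Finset.sum_comm]
  simp_rw [Finset.mul_sum]

section Defect

variable {X₂ C₂ Z : Type*} [Fintype X₂] [Fintype C₂] [DecidableEq C₂] [Fintype Z] [DecidableEq Z]

theorem outputDefect_isHermitian {X₂ C₂ Z : Type*} [Fintype X₂] [Fintype Z]
    [DecidableEq Z] (f : X₂ → Z) {ρ : X₂ → Matrix C₂ C₂ ℂ}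
    (hρ : ∀ y, (ρ y).PosSemidef) (z : Z) : (outputDefect f ρ z).IsHermitian := by
  rw [Matrix.IsHermitian, outputDefect, Matrix.conjTranspose_sum]
  refine Finset.sum_congr rfl fun y _ => ?_
  rw [Matrix.conjTranspose_smul, (hρ y).1.eq, Complex.star_def, Complex.conj_ofReal]

theorem sum_traceNorm_outputDefect_le_two [Nonempty Z] (f : X₂ → Z) {ρ : X₂ → Matrix C₂ C₂ ℂ}
    (hρ : ∀ y, (ρ y).PosSemidef) (htr : ∑ y, (ρ y).trace.re = 1) :
    ∑ z, traceNorm (outputDefect f ρ z) ≤ 2 := by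
  calc _ ≤ ∑ z, ∑ y, |(if f y = z then (1 : ℝ) else 0) - (Fintype.card Z : ℝ)⁻¹|
        * (ρ y).trace.re := Finset.sum_le_sum fun z _ => traceNorm_sum_smul_le _ hρ
    _ = ∑ y, (∑ z, |(if f y = z then (1 : ℝ) else 0) - (Fintype.card Z : ℝ)⁻¹|)
        * (ρ y).trace.re := by
        rw [Finset.sum_comm]
        simp_rw [Finset.sum_mul]
    _ ≤ ∑ y, 2 * (ρ y).trace.re := by
        refine Finset.sum_le_sum fun y _ => mul_le_mul_of_nonneg_right ?_
          (Complex.nonneg_iff.1 (hρ y).trace_nonneg).1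
        calc _ ≤ ∑ z, ((if f y = z then (1 : ℝ) else 0) + (Fintype.card Z : ℝ)⁻¹) := by
              refine Finset.sum_le_sum fun z _ => (abs_sub _ _).trans_eq ?_
              rw [abs_of_nonneg (by positivity : (0 : ℝ) ≤ (Fintype.card Z : ℝ)⁻¹),
                abs_of_nonneg (by split_ifs <;> norm_num)]
          _ = 2 := by
              rw [Finset.sum_add_distrib]
              simp
              norm_num
    _ = 2 := by rw [← Finset.mul_sum, htr, mul_one]

/-- The summed squared weighted Hilbert–Schmidt norms of the defects, expanded over pairs. -/
theorem sum_trace_outputDefect_sq {X₂ C₂ Z : Type*} [Fintype X₂] [Fintype C₂] [Fintype Z]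
    [DecidableEq Z] [Nonempty Z] (f : X₂ → Z) (ρ : X₂ → Matrix C₂ C₂ ℂ)
    (T : Matrix C₂ C₂ ℂ) :
    ∑ z, (T * outputDefect f ρ z * (T * outputDefect f ρ z)).trace.re
      = ∑ y, ∑ y', ((if f y = f y' then (1 : ℝ) else 0) - (Fintype.card Z : ℝ)⁻¹)
          * (T * ρ y * (T * ρ y')).trace.re := by
  have h : ∀ z, (T * outputDefect f ρ z * (T * outputDefect f ρ z)).trace.re
      = ∑ y, ∑ y', ((if f y = z then (1 : ℝ) else 0) - (Fintype.card Z : ℝ)⁻¹)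
          * ((if f y' = z then (1 : ℝ) else 0) - (Fintype.card Z : ℝ)⁻¹)
          * (T * ρ y * (T * ρ y')).trace.re := by
    intro z
    rw [outputDefect, Matrix.mul_sum, Finset.sum_mul_sum, Matrix.trace_sum, Complex.re_sum]
    refine Finset.sum_congr rfl fun y _ => ?_
    rw [Matrix.trace_sum, Complex.re_sum]
    refine Finset.sum_congr rfl fun y' _ => ?_
    rw [Matrix.mul_smul, Matrix.mul_smul, Matrix.smul_mul, Matrix.mul_smul, smul_smul,
      Matrix.trace_smul, smul_eq_mul, ← Complex.ofReal_mul, Complex.re_ofReal_mul]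
  simp_rw [h]
  rw [Finset.sum_comm]
  refine Finset.sum_congr rfl fun y _ => ?_
  rw [Finset.sum_comm]
  refine Finset.sum_congr rfl fun y' _ => ?_
  rw [← Finset.sum_mul, sum_indicator_sub_mul]

/-- Conjugation by T = σ^{-1/2} turns ρ ≤ lσ into TρT ≤ l·1, which is then paired with ρ' ≥ 0. -/
theorem trace_mul_mul_le {S T σ ρ ρ' : Matrix C₂ C₂ ℂ} (hT : T.IsHermitian) (hST : S * T = 1)
    (hσ : S * S = σ) {l : ℝ} (hρ : ((l : ℂ) • σ - ρ).PosSemidef) (hρ' : ρ'.PosSemidef) :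
    (T * ρ * (T * ρ')).trace.re ≤ l * ρ'.trace.re := by
  have hTS : T * S = 1 := mul_eq_one_comm.1 hST
  have h := hρ.mul_mul_conjTranspose_same T
  have e : T * ((l : ℂ) • σ - ρ) * T.conjTranspose = (l : ℂ) • 1 - T * ρ * T := by
    rw [hT.eq, Matrix.mul_sub, Matrix.sub_mul, ← hσ, Matrix.mul_smul, Matrix.smul_mul,
      ← Matrix.mul_assoc, hTS, Matrix.one_mul, hST]
  rw [e] at h
  have h' := trace_mul_re_nonneg h hρ'
  rw [Matrix.sub_mul, Matrix.smul_mul, Matrix.one_mul, Matrix.trace_sub, Matrix.trace_smul,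
    smul_eq_mul, Complex.sub_re, Complex.re_ofReal_mul] at h'
  rw [← Matrix.mul_assoc]
  linarith

theorem exists_posDef_sqrt {σ : Matrix C₂ C₂ ℂ} (hσ : σ.PosDef) :
    ∃ S T : Matrix C₂ C₂ ℂ, S.PosSemidef ∧ T.IsHermitian ∧ S * T = 1 ∧ S * S = σ := by
  have hS : (CFC.sqrt σ).PosSemidef := Matrix.nonneg_iff_posSemidef.1 (CFC.sqrt_nonneg σ)
  have hSS : CFC.sqrt σ * CFC.sqrt σ = σ :=
    CFC.sqrt_mul_sqrt_self σ (Matrix.nonneg_iff_posSemidef.2 hσ.posSemidef)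
  have hu : IsUnit (CFC.sqrt σ).det := by
    have := (Matrix.isUnit_iff_isUnit_det _).1 hσ.isUnit
    rw [← hSS, Matrix.det_mul] at this
    exact isUnit_of_mul_isUnit_left this
  exact ⟨_, (CFC.sqrt σ)⁻¹, hS, hS.1.inv, Matrix.mul_nonsing_inv _ hu, hSS⟩

end Defect

/-! ### Second-moment bound for deor -/

section Deor

variable {n m r : ℕ} {C : Type*} [Fintype C] [DecidableEq C]

theorem card_bits (m : ℕ) : (Fintype.card (Bits m) : ℝ) = 2 ^ m := by simp

theorem sum_trace_outputDefect_deor_le (𝒜 : Fin m → Matrix (Fin n) (Fin n) (ZMod 2))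
    (h𝒜 : ∀ s : Fin m → ZMod 2, s ≠ 0 → (n : ℤ) - (r : ℤ) ≤ ((∑ i, s i • 𝒜 i).rank : ℤ))
    {ρ : Bits n → Matrix C C ℂ} (hρ : ∀ y, (ρ y).PosSemidef) (htr : ∑ y, (ρ y).trace.re = 1)
    {S T σ : Matrix C C ℂ} (hT : T.IsHermitian) (hST : S * T = 1) (hσ : S * S = σ) {l : ℝ}
    (hl : ∀ y, ((l : ℂ) • σ - ρ y).PosSemidef) (hl0 : 0 ≤ l) :
    ∑ x, ∑ z, (T * outputDefect (deor 𝒜 x) ρ z * (T * outputDefect (deor 𝒜 x) ρ z)).trace.re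
      ≤ ((2 : ℝ) ^ m)⁻¹ * 2 ^ n * ((2 ^ m - 1) * 2 ^ r) * l := by
  let K : Bits n → ℝ := fun d =>
    ∑ x : Bits n, ((if deor 𝒜 x d = 0 then (1 : ℝ) else 0) - ((2 : ℝ) ^ m)⁻¹)
  -- Nonnegativity, visible only on the character side, permits bounding the pair traces term by
  -- term below.
  have hK : ∀ d, 0 ≤ K d := fun d => by
    simp only [K]
    rw [sum_deor_eq_zero_sub]
    refine mul_nonneg (by positivity) (Finset.sum_nonneg fun s _ => ?_)
    split_ifs <;> norm_num
  calc _ = ∑ y', ∑ y, K (y - y') * (T * ρ y * (T * ρ y')).trace.re := by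
        simp_rw [sum_trace_outputDefect_sq, card_bits]
        have hK' : ∀ y y', K (y - y')
            = ∑ x, ((if deor 𝒜 x y = deor 𝒜 x y' then (1 : ℝ) else 0) - ((2 : ℝ) ^ m)⁻¹) := by
          intro y y'
          simp only [K, deor_sub_right, sub_eq_zero]
        simp_rw [hK', Finset.sum_mul]
        rw [Finset.sum_comm]
        conv_rhs => rw [Finset.sum_comm]
        refine Finset.sum_congr rfl fun y _ => ?_
        rw [Finset.sum_comm]
    _ ≤ ∑ y', ∑ y, K (y - y') * (l * (ρ y').trace.re) :=
        Finset.sum_le_sum fun y' _ => Finset.sum_le_sum fun y _ =>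
          mul_le_mul_of_nonneg_left (trace_mul_mul_le hT hST hσ (hl y) (hρ y')) (hK _)
    _ = ∑ y', (∑ d, K d) * (l * (ρ y').trace.re) := by
        refine Finset.sum_congr rfl fun y' _ => ?_
        rw [← Finset.sum_mul]
        congr 1
        exact Equiv.sum_comp (Equiv.subRight y') K
    _ = (∑ d, K d) * l := by
        rw [← Finset.mul_sum, ← Finset.mul_sum, htr, mul_one]
    _ ≤ _ := mul_le_mul_of_nonneg_right (sum_sum_deor_eq_zero_sub_le 𝒜 h𝒜) hl0

/-- The squared distance from uniform of the output is controlled by the collision weights. -/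
theorem sq_sum_traceNorm_outputDefect_deor_le (𝒜 : Fin m → Matrix (Fin n) (Fin n) (ZMod 2))
    (h𝒜 : ∀ s : Fin m → ZMod 2, s ≠ 0 → (n : ℤ) - (r : ℤ) ≤ ((∑ i, s i • 𝒜 i).rank : ℤ))
    {ρ : Bits n → Matrix C C ℂ} (hρ : ∀ y, (ρ y).PosSemidef) (htr : ∑ y, (ρ y).trace.re = 1)
    {σ : Matrix C C ℂ} (hσ : σ.PosDef) (hσ1 : σ.trace = 1) {l : ℝ}
    (hl : ∀ y, ((l : ℂ) • σ - ρ y).PosSemidef) (hl0 : 0 ≤ l)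
    {P : Bits n → ℝ} (hP : ∀ x, 0 ≤ P x) (hP1 : ∑ x, P x = 1) {p : ℝ} (hp : ∀ x, P x ≤ p) :
    (∑ x, P x * ∑ z, traceNorm (outputDefect (deor 𝒜 x) ρ z)) ^ 2
      ≤ p * (2 ^ n * ((2 ^ m - 1) * 2 ^ r)) * l := by
  obtain ⟨S, T, hS, hT, hST, hSS⟩ := exists_posDef_sqrt hσ
  set D := ∑ x, P x * ∑ z, traceNorm (outputDefect (deor 𝒜 x) ρ z) with hD
  set c : Bits n → Bits m → ℝ := fun x z =>
    (T * outputDefect (deor 𝒜 x) ρ z * (T * outputDefect (deor 𝒜 x) ρ z)).trace.re with hc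
  have hc0 : ∀ x z, 0 ≤ c x z := fun x z => by
    have h := two_mul_traceNorm_le (outputDefect_isHermitian (deor 𝒜 x) hρ z) hS hT hST 0
    simpa using h
  have hp0 : 0 ≤ p := (hP 0).trans (hp 0)
  have hm : (0 : ℝ) < 2 ^ m := by positivity
  have hW := sum_trace_outputDefect_deor_le 𝒜 h𝒜 hρ htr hT hST hSS hl hl0
  have key : ∀ t : ℝ, 2 * t * D ≤ t ^ 2 * 2 ^ m
      + p * (((2 : ℝ) ^ m)⁻¹ * 2 ^ n * ((2 ^ m - 1) * 2 ^ r) * l) := by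
    intro t
    calc 2 * t * D = ∑ x, P x * ∑ z, 2 * t * traceNorm (outputDefect (deor 𝒜 x) ρ z) := by
          rw [hD, Finset.mul_sum]
          refine Finset.sum_congr rfl fun x _ => ?_
          rw [← Finset.mul_sum]
          ring
      _ ≤ ∑ x, P x * ∑ z, (t ^ 2 + c x z) := by
          refine Finset.sum_le_sum fun x _ => mul_le_mul_of_nonneg_left ?_ (hP x)
          refine Finset.sum_le_sum fun z _ => ?_
          have := two_mul_traceNorm_le (outputDefect_isHermitian (deor 𝒜 x) hρ z) hS hT hST t
          rwa [hSS, hσ1, Complex.one_re, mul_one] at this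
      _ = t ^ 2 * 2 ^ m + ∑ x, P x * ∑ z, c x z := by
          simp_rw [Finset.sum_add_distrib, mul_add, Finset.sum_add_distrib]
          rw [← Finset.sum_mul, hP1, one_mul, Finset.sum_const, Finset.card_univ, nsmul_eq_mul,
            card_bits, mul_comm]
      _ ≤ t ^ 2 * 2 ^ m + ∑ x, p * ∑ z, c x z := by
          refine add_le_add_right (Finset.sum_le_sum fun x _ => ?_) _
          exact mul_le_mul_of_nonneg_right (hp x) (Finset.sum_nonneg fun z _ => hc0 x z)
      _ ≤ _ := by
          rw [← Finset.mul_sum]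
          exact add_le_add_right (mul_le_mul_of_nonneg_left hW hp0) _
  -- t = D / 2^m maximizes 2tD - t² 2^m.
  have h := mul_le_mul_of_nonneg_left (key (D / 2 ^ m)) hm.le
  have e1 : (2 : ℝ) ^ m * (2 * (D / 2 ^ m) * D) = 2 * D ^ 2 := by field_simp
  have e2 : (2 : ℝ) ^ m * ((D / 2 ^ m) ^ 2 * 2 ^ m
      + p * (((2 : ℝ) ^ m)⁻¹ * 2 ^ n * ((2 ^ m - 1) * 2 ^ r) * l))
      = D ^ 2 + p * (2 ^ n * ((2 ^ m - 1) * 2 ^ r)) * l := by field_simp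
  rw [e1, e2] at h
  linarith

end Deor

theorem half_le_two_rpow {D k₁ k₂ : ℝ} {n m r : ℕ} (hD : D ≤ 2) (hD0 : 0 ≤ D)
    (h : D ^ 2 ≤ (2 : ℝ) ^ (-k₁) * (2 ^ n * ((2 ^ m - 1) * 2 ^ r)) * (2 : ℝ) ^ (-k₂)) :
    1 / 2 * D ≤ (2 : ℝ) ^ (-((k₁ + k₂ + 3 - (n : ℝ) - (r : ℝ) - 2 * (m : ℝ)) / 4)) := by
  -- For m = 0 the factor 2^m - 1 vanishes, forcing D = 0.
  rcases Nat.eq_zero_or_pos m with rfl | hm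
  · have : D = 0 := by
      simp at h
      exact h
    rw [this, mul_zero]
    positivity
  have hm1 : (1 : ℝ) ≤ m := by exact_mod_cast hm
  -- Put E = k₁ + k₂ - n - r. The squared bound 2^{m-2-E} is at most the square 2^{m-(E+3)/2} of the
  -- claim exactly when E ≥ -1; below that the claim is at least 1, as m ≥ 1.
  rcases lt_or_ge (k₁ + k₂ - n - r) (-1) with hE | hE
  · calc 1 / 2 * D ≤ 1 := by linarith
      _ ≤ _ := Real.one_le_rpow (by norm_num) (by linarith)
  · have hpos : (0 : ℝ) < (2 : ℝ) ^ (-((k₁ + k₂ + 3 - (n : ℝ) - (r : ℝ) - 2 * (m : ℝ)) / 4)) := by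
      positivity
    refine (pow_le_pow_iff_left₀ (by positivity) hpos.le two_ne_zero).1 ?_
    have h1 : D ^ 2 ≤ (2 : ℝ) ^ (m + n + r - k₁ - k₂ : ℝ) := by
      have e : (2 : ℝ) ^ (m + n + r - k₁ - k₂ : ℝ)
          = (2 : ℝ) ^ (-k₁) * (2 ^ n * (2 ^ m * 2 ^ r)) * (2 : ℝ) ^ (-k₂) := by
        simp only [← Real.rpow_natCast]
        rw [← Real.rpow_add two_pos, ← Real.rpow_add two_pos, ← Real.rpow_add two_pos,
          ← Real.rpow_add two_pos]
        congr 1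
        ring
      rw [e]
      refine h.trans ?_
      gcongr
      linarith
    calc (1 / 2 * D) ^ 2 = (2 : ℝ) ^ (-2 : ℝ) * D ^ 2 := by
          rw [Real.rpow_neg two_pos.le]
          norm_num
          ring
      _ ≤ (2 : ℝ) ^ (-2 : ℝ) * (2 : ℝ) ^ (m + n + r - k₁ - k₂ : ℝ) := by gcongr
      _ = (2 : ℝ) ^ (-2 + (m + n + r - k₁ - k₂) : ℝ) := (Real.rpow_add two_pos _ _).symm
      _ ≤ (2 : ℝ) ^ (-((k₁ + k₂ + 3 - (n : ℝ) - (r : ℝ) - 2 * (m : ℝ)) / 4) * 2) :=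
          Real.rpow_le_rpow_of_exponent_le (by norm_num) (by linarith)
      _ = _ := by
          rw [Real.rpow_mul two_pos.le]
          norm_num

end QExt

theorem mainTheorem6 (n m r : ℕ) (𝒜 : Fin m → Matrix (Fin n) (Fin n) (ZMod 2))
    (h𝒜 : ∀ s : Fin m → ZMod 2, s ≠ 0 → (n : ℤ) - (r : ℤ) ≤ ((∑ i, s i • 𝒜 i).rank : ℤ))
    (k₁ k₂ : ℝ) :
    QExt.IsX₁StrongQuantumProductExtractor.{u, v} (QExt.deor 𝒜) k₁ k₂
      ((2 : ℝ) ^ (-((k₁ + k₂ + 3 - (n : ℝ) - (r : ℝ) - 2 * (m : ℝ)) / 4))) := by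
  intro C₁ C₂ _ _ _ _ ρ₁ ρ₂ hd₁ hc₁ hd₂ hc₂ hk₁ hk₂
  rw [QExt.traceDist_outputStateX₁_eq _ _ hc₁ hd₁.1]
  have hρ : ∀ y, (QExt.condOp ρ₂ y).PosSemidef := QExt.condOp_posSemidef hd₂.1
  have hP : ∀ x, 0 ≤ (QExt.condOp ρ₁ x).trace.re := fun x =>
    (Complex.nonneg_iff.1 (QExt.condOp_posSemidef hd₁.1 x).trace_nonneg).1
  have hP1 := QExt.sum_trace_condOp hd₁
  have htr := QExt.sum_trace_condOp hd₂
  -- The bound is proved for every z < k₂ and passes to the limit, since a positive definite σ is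
  -- only available with slack.
  refine QExt.half_le_two_rpow ?_ ?_ (QExt.le_mul_two_rpow_neg fun z hz => ?_)
  · calc _ ≤ ∑ x, (QExt.condOp ρ₁ x).trace.re * 2 :=
          Finset.sum_le_sum fun x _ => mul_le_mul_of_nonneg_left
            (QExt.sum_traceNorm_outputDefect_le_two _ hρ htr) (hP x)
      _ = 2 := by rw [← Finset.sum_mul, hP1, one_mul]
  · exact Finset.sum_nonneg fun x _ => mul_nonneg (hP x)
      (Finset.sum_nonneg fun z _ => QExt.traceNorm_nonneg _)
  · obtain ⟨σ, hσ, hσ1, hl⟩ := QExt.exists_posDef_of_lt_minEntropy hk₂ hz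
    exact QExt.sq_sum_traceNorm_outputDefect_deor_le 𝒜 h𝒜 hρ htr hσ hσ1 hl (by positivity)
      hP hP1 (QExt.trace_condOp_le hk₁)
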